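/- Setting. For an $n$-qubit Hermitian $H\neq 0$ with Pauli expansion $H=\sum_s c_sP_s$ over tensor products $P_s$ of $I,X,Y,Z$, put $E=\sum_s|c_s|$. A zeroth-order query to the sampling oracle $\mathcal O_H$ consists of an ansatz (a starting pure state $|\Psi\rangle$ and Hermitian generators $A_1,\dots,A_p$, for any $p$) and a parameter $\theta\in\mathbb R^p$. The oracle draws $s$ with probability $|c_s|/E$, measures the observable $\operatorname{sign}(c_s)P_s$ on the state $|\theta\rangle=e^{-iA_p\theta_p/2}\cdots e^{-iA_1\theta_1/2}|\Psi\rangle$, and returns $E$ times the $\pm1$ outcome. A zeroth-order algorithm $\mathcal A$ is a possibly randomized, adaptive classical algorithm that makes such queries (each one, including its ansatz, may depend on its internal randomness and on all earlier answers) and outputs an $n$-qubit pure state $|\psi\rangle$. For a set $\mathcal H$ of observables let $$\mathrm{Err}(\mathcal A,\mathcal H)=\sup_{H\in\mathcal H}\mathbb E\big[\langle\psi|H|\psi\rangle-\lambda_{\min}(H)\big],$$ where the expectation is over the output of $\mathcal A$ when it interacts with $\mathcal O_H$. The $\mu$-optimum of $\mathcal H$ is the set of pure states $|\phi\rangle$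 with $\langle\phi|H|\phi\rangle-\lambda_{\min}(H)\le\mu$ for at least one $H\in\mathcal H$. $\mathcal A$ is a $\mu$-vicinity algorithm for $\mathcal H$ if, for every $H\in\mathcal H$, when run with $\mathcal O_H$ it queries only states in the $\mu$-optimum of $\mathcal H$. Finally, with $\delta=\sqrt{45\epsilon/n}$, let $$\mathcal H_n^\epsilon=\Big\{-\sum_{i=1}^n\big[\sin(\tfrac{\pi}{4}+v_i\delta)X_i+\cos(\tfrac{\pi}{4}+v_i\delta)Z_i\big] : v\in\{-1,1\}^n\Big\}.$$ Theorem (Zeroth-order lower bound). There is a universal constant $c>0$ such that for all integers $n\ge 15$ and all real $\epsilon$ with $0<\epsilon\le 0.01\,n$ the following holds. If $\mathcal A$ is a zeroth-order, $100\epsilon$-vicinity algorithm for $\mathcal H_n^\epsilon$ that makes at most $T$ queries when run with $\mathcal O_H$, for every $H\in\mathcal H_n^\epsilon$, and $\mathrm{Err}(\mathcal A,\mathcal H_n^\epsilon)\le\epsilon$, then $$T\ \ge\ c\,\frac{n^3}{\epsilon^2}.$$ -/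

import Mathlib

open scoped ENNReal

noncomputable section

namespace VarOpt

/-! ### Qubits, pure states and expectation values -/

/-- Computational basis labels of `n` qubits. -/
abbrev Basis (n : ℕ) : Type := Fin n → Fin 2

/-- Linear operators on `n` qubits, as matrices in the computational basis. -/
abbrev Operator (n : ℕ) : Type := Matrix (Basis n) (Basis n) ℂ

/-- Normalized pure states on `n` qubits. -/
abbrev PureState (n : ℕ) : Type := {ψ : EuclideanSpace ℂ (Basis n) // ‖ψ‖ = 1}

/-- The expectation value `⟨ψ|A|ψ⟩` (its real part, which is all of it when `A` is Hermitian). -/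
def expval {n : ℕ} (A : Operator n) (ψ : PureState n) : ℝ :=
  (inner ℂ ψ.1 (Matrix.toEuclideanLin A ψ.1)).re

/-- The smallest eigenvalue of a Hermitian operator. -/
def lambdaMin {n : ℕ} (H : Operator n) : ℝ := sInf (spectrum ℝ H)

theorem norm_unitary_apply {n : ℕ} {U : Operator n} (hU : U ∈ unitary (Operator n))
    (ψ : EuclideanSpace ℂ (Basis n)) : ‖Matrix.toEuclideanLin U ψ‖ = ‖ψ‖ := by
  have h : (inner ℂ (Matrix.toEuclideanLin U ψ) (Matrix.toEuclideanLin U ψ) : ℂ)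
      = inner ℂ ψ ψ := by
    rw [← LinearMap.adjoint_inner_right, ← Matrix.toEuclideanLin_conjTranspose_eq_adjoint]
    congr 1
    have h1 : U.conjTranspose * U = 1 := hU.1
    simp only [Matrix.toLpLin_apply, Matrix.mulVec_mulVec, h1, Matrix.one_mulVec]
  have h2 : ‖Matrix.toEuclideanLin U ψ‖ ^ 2 = ‖ψ‖ ^ 2 := by
    rw [inner_self_eq_norm_sq_to_K, inner_self_eq_norm_sq_to_K] at h
    exact_mod_cast h
  exact (sq_eq_sq₀ (norm_nonneg _) (norm_nonneg _)).1 h2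

/-! ### Pauli operators -/

/-- Labels of the single-qubit Pauli operators (with the identity). -/
inductive Pauli : Type
  | I | X | Y | Z
  deriving DecidableEq

instance : Fintype Pauli where
  elems := {Pauli.I, Pauli.X, Pauli.Y, Pauli.Z}
  complete := fun P => by cases P <;> decide

/-- The single-qubit Pauli matrices. -/
def Pauli.mat : Pauli → Matrix (Fin 2) (Fin 2) ℂ
  | .I => 1
  | .X => !![0, 1; 1, 0]
  | .Y => !![0, -Complex.I; Complex.I, 0]
  | .Z => !![1, 0; 0, -1]

/-- The tensor product `σ_{s 0} ⊗ ⋯ ⊗ σ_{s (n-1)}` of Pauli matrices. -/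
def pauliString {n : ℕ} (s : Fin n → Pauli) : Operator n :=
  Matrix.of fun a b => ∏ i, (s i).mat (a i) (b i)

/-- The operator acting as the Pauli matrix `P` on qubit `i` and trivially on the other qubits. -/
def pauliAt {n : ℕ} (P : Pauli) (i : Fin n) : Operator n :=
  pauliString (Function.update (fun _ => Pauli.I) i P)

theorem Pauli.mat_conjTranspose (P : Pauli) : P.mat.conjTranspose = P.mat := by
  cases P <;> ext i j <;> fin_cases i <;> fin_cases j <;> simp [Pauli.mat]

theorem Pauli.mat_mul_self (P : Pauli) : P.mat * P.mat = 1 := by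
  cases P <;> ext i j <;> fin_cases i <;> fin_cases j <;> simp [Pauli.mat]

theorem pauliString_conjTranspose {n : ℕ} (s : Fin n → Pauli) :
    (pauliString s).conjTranspose = pauliString s := by
  ext a b
  simp only [Matrix.conjTranspose_apply, pauliString, Matrix.of_apply, star_prod]
  refine Finset.prod_congr rfl fun i _ => ?_
  have h := congrFun (congrFun (Pauli.mat_conjTranspose (s i)) (a i)) (b i)
  simpa [Matrix.conjTranspose_apply] using h

theorem pauliString_mul_self {n : ℕ} (s : Fin n → Pauli) :
    pauliString s * pauliString s = 1 := by
  ext a c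
  simp only [Matrix.mul_apply, pauliString, Matrix.of_apply, ← Finset.prod_mul_distrib]
  have h := Finset.prod_univ_sum (fun _ : Fin n => (Finset.univ : Finset (Fin 2)))
    (fun i b => (s i).mat (a i) b * (s i).mat b (c i))
  rw [Fintype.piFinset_univ] at h
  rw [← h]
  have h2 : ∀ i, ∑ b, (s i).mat (a i) b * (s i).mat b (c i)
      = (1 : Matrix (Fin 2) (Fin 2) ℂ) (a i) (c i) := fun i => by
    rw [← Pauli.mat_mul_self (s i), Matrix.mul_apply]
  simp only [h2, Matrix.one_apply, Finset.prod_ite_zero, Finset.prod_const_one, Finset.mem_univ,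
    forall_true_left, funext_iff]

theorem pauliString_mem_unitary {n : ℕ} (s : Fin n → Pauli) :
    pauliString s ∈ unitary (Operator n) := by
  rw [Unitary.mem_iff, Matrix.star_eq_conjTranspose, pauliString_conjTranspose]
  exact ⟨pauliString_mul_self s, pauliString_mul_self s⟩

theorem abs_expval_pauliString_le {n : ℕ} (s : Fin n → Pauli) (ψ : PureState n) :
    |expval (pauliString s) ψ| ≤ 1 := by
  refine (Complex.abs_re_le_norm _).trans ((norm_inner_le_norm _ _).trans ?_)
  rw [norm_unitary_apply (pauliString_mem_unitary s), ψ.2, one_mul]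

/-! ### Zeroth-order behavior of the sampling oracle -/

/-- The coefficient of the Pauli string `s` in the Pauli expansion
`H = ∑ s, pauliCoeff H s • pauliString s` of a Hermitian operator `H`. -/
def pauliCoeff {n : ℕ} (H : Operator n) (s : Fin n → Pauli) : ℝ :=
  ((pauliString s * H).trace / 2 ^ n).re

/-- The normalization factor `E`, the sum of the absolute values of the Pauli coefficients. -/
def pauliNorm {n : ℕ} (H : Operator n) : ℝ := ∑ s, |pauliCoeff H s|

/-- The distribution on Pauli strings proportional to the absolute values of the coefficients. -/
def sampleTerm {n : ℕ} (H : Operator n) (hH : ∃ s, pauliCoeff H s ≠ 0) :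
    PMF (Fin n → Pauli) :=
  PMF.normalize (fun s => ENNReal.ofReal |pauliCoeff H s|)
    (by
      obtain ⟨s, hs⟩ := hH
      intro h
      have := ENNReal.tsum_eq_zero.1 h s
      simp only [ENNReal.ofReal_eq_zero, abs_nonpos_iff] at this
      exact hs this)
    (by
      rw [tsum_fintype]
      exact ENNReal.sum_ne_top.2 fun _ _ => ENNReal.ofReal_ne_top)

/-- The Born rule for measuring the Pauli string `s` on the state `ψ`: the outcome `m = ±1` has
probability `⟨ψ|(1 + m P)/2|ψ⟩`. -/
def measurePauli {n : ℕ} (s : Fin n → Pauli) (ψ : PureState n) : PMF ℤˣ :=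
  PMF.ofFintype (fun m => ENNReal.ofReal ((1 + ((m : ℤ) : ℝ) * expval (pauliString s) ψ) / 2))
    (by
      have h := abs_le.1 (abs_expval_pauliString_le s ψ)
      rw [UnitsInt.univ, Finset.sum_pair (by decide), ← ENNReal.ofReal_add]
      · rw [← ENNReal.ofReal_one]
        congr 1
        push_cast
        ring
      · push_cast
        linarith [h.1]
      · push_cast
        linarith [h.2])

open Classical in
/-- The law of the answer of the sampling oracle encoding `H` to a zeroth-order query of the state
`ψ`. Writing `H = ∑ |c_s| (sign c_s P_s)`, it samples a string `s` with probability `|c_s| / E`,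
measures the observable `sign c_s P_s` and returns `E` times the outcome. (For `H = 0` there is no
term to sample, and the answer is `0 = E`.) -/
def oracle {n : ℕ} (H : Operator n) (ψ : PureState n) : PMF ℝ :=
  if hH : ∃ s, pauliCoeff H s ≠ 0 then
    (sampleTerm H hH).bind fun s =>
      (measurePauli s ψ).map fun m =>
        pauliNorm H * (((SignType.sign (pauliCoeff H s) : SignType) : ℝ) * ((m : ℤ) : ℝ))
  else PMF.pure 0

/-! ### Variational ansätze and zeroth-order queries -/

/-- A state parameterization with `numParams` pulses: a starting state and Hermitian pulse
generators. -/
structure Ansatz (n : ℕ) : Type where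
  numParams : ℕ
  start : PureState n
  gen : Fin numParams → Operator n
  gen_isHermitian : ∀ j, (gen j).IsHermitian

/-- The pulse `exp (-i A_j θ_j / 2)`. -/
def Ansatz.pulse {n : ℕ} (Θ : Ansatz n) (θ : Fin Θ.numParams → ℝ) (j : Fin Θ.numParams) :
    Operator n :=
  NormedSpace.exp ((-(Complex.I * (θ j : ℂ) / 2)) • Θ.gen j)

theorem Ansatz.pulse_mem_unitary {n : ℕ} (Θ : Ansatz n) (θ : Fin Θ.numParams → ℝ)
    (j : Fin Θ.numParams) : Θ.pulse θ j ∈ unitary (Operator n) := by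
  have h1 : star (Θ.pulse θ j) = NormedSpace.exp (-((-(Complex.I * (θ j : ℂ) / 2)) • Θ.gen j)) := by
    rw [Matrix.star_eq_conjTranspose, Ansatz.pulse, ← Matrix.exp_conjTranspose,
      Matrix.conjTranspose_smul, (Θ.gen_isHermitian j).eq, ← neg_smul]
    congr 2
    simp
    ring
  have h2 : star (Θ.pulse θ j) = (Θ.pulse θ j)⁻¹ := by
    rw [h1, Matrix.exp_neg]
    rfl
  have h3 : IsUnit (Θ.pulse θ j).det :=
    (Matrix.isUnit_iff_isUnit_det _).1 (Matrix.isUnit_exp _)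
  rw [Unitary.mem_iff, h2]
  exact ⟨Matrix.nonsing_inv_mul _ h3, Matrix.mul_nonsing_inv _ h3⟩

/-- The whole circuit `exp (-i A_p θ_p / 2) ⋯ exp (-i A_1 θ_1 / 2)`. -/
def Ansatz.circuit {n : ℕ} (Θ : Ansatz n) (θ : Fin Θ.numParams → ℝ) : Operator n :=
  (List.ofFn (Θ.pulse θ)).reverse.prod

theorem Ansatz.circuit_mem_unitary {n : ℕ} (Θ : Ansatz n) (θ : Fin Θ.numParams → ℝ) :
    Θ.circuit θ ∈ unitary (Operator n) := by
  refine Submonoid.list_prod_mem _ fun U hU => ?_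
  rw [List.mem_reverse, List.mem_ofFn] at hU
  obtain ⟨j, rfl⟩ := hU
  exact Θ.pulse_mem_unitary θ j

/-- The variational state `|θ⟩`. -/
def Ansatz.state {n : ℕ} (Θ : Ansatz n) (θ : Fin Θ.numParams → ℝ) : PureState n :=
  ⟨Matrix.toEuclideanLin (Θ.circuit θ) Θ.start.1, by
    rw [norm_unitary_apply (Θ.circuit_mem_unitary θ), Θ.start.2]⟩

/-- A zeroth-order query, that is, a query with empty coordinate multiset: an ansatz and a
parameter. Different queries may use different ansätze. -/
structure ZerothOrderQuery (n : ℕ) : Type where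
  ansatz : Ansatz n
  param : Fin ansatz.numParams → ℝ

/-- The state that a query asks the oracle to prepare. -/
def ZerothOrderQuery.state {n : ℕ} (q : ZerothOrderQuery n) : PureState n :=
  q.ansatz.state q.param

/-! ### Zeroth-order black-box algorithms -/

/-- A deterministic adaptive algorithm with zeroth-order queries: it either halts with an output
state, or makes a query and continues depending on the real number returned by the oracle. -/
inductive Strategy (n : ℕ) : Type
  | halt (output : PureState n) : Strategy n
  | query (q : ZerothOrderQuery n) (next : ℝ → Strategy n) : Strategy n

namespace Strategy

/-- The law of the output state when the oracle encodes `H`. -/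
def run {n : ℕ} (H : Operator n) : Strategy n → PMF (PureState n)
  | halt ψ => PMF.pure ψ
  | query q next => (oracle H q.state).bind fun y => (next y).run H

/-- When the oracle encodes `H`, at most `T` queries are made, whatever answers of positive
probability are returned. -/
def MakesAtMost {n : ℕ} (H : Operator n) : ℕ → Strategy n → Prop
  | _, halt _ => True
  | 0, query _ _ => False
  | T + 1, query q next => ∀ y ∈ (oracle H q.state).support, (next y).MakesAtMost H T

/-- When the oracle encodes `H`, only states in `D` are queried, whatever answers of positive
probability are returned. -/
def QueriesOnlyIn {n : ℕ} (H : Operator n) (D : Set (PureState n)) : Strategy n → Prop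
  | halt _ => True
  | query q next => q.state ∈ D ∧
      ∀ y ∈ (oracle H q.state).support, (next y).QueriesOnlyIn H D

/-- The expectation, over the answers of the oracle encoding `H`, of the optimization error
`⟨ψ|H|ψ⟩ - λ_min H` of the output `ψ`. This error is nonnegative for Hermitian `H`. -/
def expectedError {n : ℕ} (H : Operator n) (A : Strategy n) : ℝ≥0∞ :=
  ∑' ψ, A.run H ψ * ENNReal.ofReal (expval H ψ - lambdaMin H)

end Strategy

/-- The `μ`-optimum of a set `𝓗` of observables: the union of the `μ`-optima of its members. -/
def optimumSet {n : ℕ} (𝓗 : Set (Operator n)) (μ : ℝ) : Set (PureState n) :=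
  {ψ | ∃ H ∈ 𝓗, expval H ψ - lambdaMin H ≤ μ}

/-- A randomized adaptive algorithm with zeroth-order queries: a random seed with an arbitrary
probability law, together with a deterministic strategy for each value of the seed. -/
structure ZerothOrderAlgorithm (n : ℕ) (Ω : Type*) [MeasurableSpace Ω] where
  seedLaw : MeasureTheory.Measure Ω
  isProbabilityMeasure : MeasureTheory.IsProbabilityMeasure seedLaw
  strategy : Ω → Strategy n

namespace ZerothOrderAlgorithm

variable {n : ℕ} {Ω : Type*} [MeasurableSpace Ω]

/-- At most `T` queries are made, for every observable in `𝓗`. -/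
def MakesAtMost (A : ZerothOrderAlgorithm n Ω) (𝓗 : Set (Operator n)) (T : ℕ) : Prop :=
  ∀ H ∈ 𝓗, ∀ᵐ ω ∂A.seedLaw, (A.strategy ω).MakesAtMost H T

/-- The algorithm is a `μ`-vicinity algorithm for `𝓗`: for every observable in `𝓗` it queries only
states in the `μ`-optimum of `𝓗`. -/
def IsVicinity (A : ZerothOrderAlgorithm n Ω) (𝓗 : Set (Operator n)) (μ : ℝ) : Prop :=
  ∀ H ∈ 𝓗, ∀ᵐ ω ∂A.seedLaw, (A.strategy ω).QueriesOnlyIn H (optimumSet 𝓗 μ)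

/-- For every observable in `𝓗`, the expected error given the seed is a measurable function of the
seed, so that its expectation over the seed makes sense. -/
def IsMeasurable (A : ZerothOrderAlgorithm n Ω) (𝓗 : Set (Operator n)) : Prop :=
  ∀ H ∈ 𝓗, AEMeasurable (fun ω => (A.strategy ω).expectedError H) A.seedLaw

/-- The optimization error `Err(A, 𝓗)`: the worst case over `H ∈ 𝓗` of the expected error, where
the expectation is over the seed and the answers of the oracle. -/
def err (A : ZerothOrderAlgorithm n Ω) (𝓗 : Set (Operator n)) : ℝ≥0∞ :=
  ⨆ H ∈ 𝓗, ∫⁻ ω, (A.strategy ω).expectedError H ∂A.seedLaw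

end ZerothOrderAlgorithm

/-! ### The family of observables -/

/-- `H^δ_v = -∑ i, (sin (π/4 + v_i δ) X_i + cos (π/4 + v_i δ) Z_i)`, for `v ∈ {-1, 1}ⁿ`. -/
def observable {n : ℕ} (δ : ℝ) (v : Fin n → ℤˣ) : Operator n :=
  -∑ i, (((Real.sin (Real.pi / 4 + ((v i : ℤ) : ℝ) * δ) : ℝ) : ℂ) • pauliAt Pauli.X i
    + ((Real.cos (Real.pi / 4 + ((v i : ℤ) : ℝ) * δ) : ℝ) : ℂ) • pauliAt Pauli.Z i)

/-- The bias parameter `δ(ε) = √(45 ε / n)`. -/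
def bias (n : ℕ) (ε : ℝ) : ℝ := Real.sqrt (45 * ε / n)

/-- The family `𝓗_n^ε` of all `H^{δ(ε)}_v` with `v ∈ {-1, 1}ⁿ`. -/
def family (n : ℕ) (ε : ℝ) : Set (Operator n) :=
  Set.range fun v : Fin n → ℤˣ => observable (bias n ε) v

end VarOpt

end

open VarOpt

/-!
The sign vector `v` of `observable δ v` is hidden from the algorithm, and the lower bound follows
from Assouad's method applied to its `n` coordinates.

*One query.* Let `x_i`, `z_i` be the expectation values of `X_i`, `Z_i` in the queried state, and
let `along i = (x_i + z_i) / √2`, `skew i = (x_i - z_i) / √2`, which satisfy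
`along i ^ 2 + skew i ^ 2 ≤ 1`. Then
`-⟨observable δ v⟩ = ∑ i, (cos δ * along i + v_i sin δ * skew i)` and the oracle normalization
`E = n √2 cos δ` does not depend on `v`, so the answer of the oracle is a coin with values `±E`
whose bias depends on `v` only through `∑ i, v_i sin δ * skew i`
(`observable_isTwoPoint`). The coin is never close to deterministic, since `|⟨observable δ v⟩| ≤ n`
is smaller than `E` by a constant factor (`le_coin_mul_one_sub_coin`). Flipping the sign `v_i`
therefore changes its law by a divergence `O(δ² skew i ^ 2 / n²)`. For states in the vicinity
`∑ i, skew i ^ 2 = O(ε)` (`sum_skew_sq_le`), and the divergences of the `n` flips add up to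
`O(ε² / n³)` per query.

*Adaptive strategies.* Instead of the relative entropy and Pinsker's inequality, the change of
measure uses the strictly concave function `x ↦ 1 - (1 - x) ^ 2`. If `P` and `Q` are the
probabilities of an output event under the coins `p` and `q`, then `P ≤ I + 1 - (1 - Q) ^ 2`, where
`I` is the expected sum of `(p - q)² / (p (1 - p))` over the queries. This is proved by induction on
the decision tree (`Strategy.value_le_info_add`, with `one_sub_sq_average_le` for one query).

*Decoding.* An output state is decoded by the signs of its skew components. A wrongly decoded sign
costs energy at least `1 - cos δ ≥ 18 ε / n` (`mul_sum_wrong_le`), where the only spectral fact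
needed is that the ground state energy is at most `-n` (`lambdaMin_observable_le`). So an error of
at most `ε` allows few wrong signs, while the change of measure forces many wrong signs on average
over `v` unless the total information `T * O(ε² / n³)` is of order `n` (`card_le_of_deterministic`).
This gives `T ≥ c n⁴ / ε²`, which is more than required. The random seed is fixed by averaging
(`exists_good_seed`).
-/

noncomputable section

namespace VarOpt

/-! ### Tensor products of single-qubit operators -/

/-- The operator `M 0 ⊗ ⋯ ⊗ M (n-1)` in the computational basis. -/
def tensor {n : ℕ} (M : Fin n → Matrix (Fin 2) (Fin 2) ℂ) : Operator n :=
  Matrix.of fun a b => ∏ i, M i (a i) (b i)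

theorem sum_basis_prod {n : ℕ} (f : Fin n → Fin 2 → ℂ) :
    ∑ b : Basis n, ∏ i, f i (b i) = ∏ i, ∑ k, f i k := by
  rw [Finset.prod_univ_sum, Fintype.piFinset_univ]

theorem tensor_mul {n : ℕ} (M N : Fin n → Matrix (Fin 2) (Fin 2) ℂ) :
    tensor M * tensor N = tensor fun i => M i * N i := by
  ext a c
  simp only [Matrix.mul_apply, tensor, Matrix.of_apply, ← Finset.prod_mul_distrib]
  exact sum_basis_prod fun i b => M i (a i) b * N i b (c i)

theorem trace_tensor {n : ℕ} (M : Fin n → Matrix (Fin 2) (Fin 2) ℂ) :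
    (tensor M).trace = ∏ i, (M i).trace := by
  simp only [Matrix.trace, Matrix.diag, tensor, Matrix.of_apply]
  exact sum_basis_prod fun i b => M i b b

theorem tensor_mulVec {n : ℕ} (M : Fin n → Matrix (Fin 2) (Fin 2) ℂ) (f : Fin n → Fin 2 → ℂ) :
    (tensor M).mulVec (fun b => ∏ i, f i (b i)) = fun a => ∏ i, (M i).mulVec (f i) (a i) := by
  ext a
  simp only [Matrix.mulVec, dotProduct, tensor, Matrix.of_apply, ← Finset.prod_mul_distrib]
  exact sum_basis_prod fun i b => M i (a i) b * f i b

theorem pauliAt_eq_tensor {n : ℕ} (P : Pauli) (i : Fin n) :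
    pauliAt P i = tensor (Function.update (fun _ => 1) i P.mat) := by
  have h : (fun j => (Function.update (fun _ => Pauli.I) i P j).mat)
      = Function.update (fun _ => (1 : Matrix (Fin 2) (Fin 2) ℂ)) i P.mat := by
    ext1 j
    by_cases hj : j = i
    · subst hj; simp
    · simp [hj, Pauli.mat]
  rw [← h]
  rfl

theorem Pauli.trace_mul (P Q : Pauli) : (P.mat * Q.mat).trace = if P = Q then 2 else 0 := by
  cases P <;> cases Q <;>
    simp [Pauli.mat, Matrix.trace_fin_two] <;> norm_num

theorem trace_pauliString_mul {n : ℕ} (s t : Fin n → Pauli) :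
    (pauliString s * pauliString t).trace = if s = t then 2 ^ n else 0 := by
  have h : pauliString s * pauliString t = tensor fun i => (s i).mat * (t i).mat :=
    tensor_mul _ _
  rw [h, trace_tensor]
  simp only [Pauli.trace_mul, Finset.prod_ite_zero, Finset.mem_univ, forall_true_left,
    funext_iff, Finset.prod_const, Finset.card_univ, Fintype.card_fin]

theorem pauliCoeff_sum {n : ℕ} (d : (Fin n → Pauli) → ℝ) (s : Fin n → Pauli) :
    pauliCoeff (∑ t, ((d t : ℝ) : ℂ) • pauliString t) s = d s := by
  have h : (2 : ℂ) ^ n ≠ 0 := pow_ne_zero _ two_ne_zero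
  simp [pauliCoeff, Finset.mul_sum, Matrix.trace_sum, trace_pauliString_mul, h]

/-! ### Expectation values -/

theorem expval_sum_smul {n : ℕ} {ι : Type*} (S : Finset ι) (c : ι → ℝ) (A : ι → Operator n)
    (ψ : PureState n) :
    expval (∑ j ∈ S, ((c j : ℝ) : ℂ) • A j) ψ = ∑ j ∈ S, c j * expval (A j) ψ := by
  simp only [expval, map_sum, LinearMap.sum_apply, inner_sum, Complex.re_sum]
  refine Finset.sum_congr rfl fun j _ => ?_
  rw [map_smul, LinearMap.smul_apply, inner_smul_right, Complex.re_ofReal_mul]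

theorem expval_add {n : ℕ} (A B : Operator n) (ψ : PureState n) :
    expval (A + B) ψ = expval A ψ + expval B ψ := by
  simp [expval]

theorem expval_neg {n : ℕ} (A : Operator n) (ψ : PureState n) :
    expval (-A) ψ = -expval A ψ := by
  simp [expval]

theorem pauliAt_X_mul_Z {n : ℕ} (i : Fin n) :
    pauliAt Pauli.X i * pauliAt Pauli.Z i = -(pauliAt Pauli.Z i * pauliAt Pauli.X i) := by
  simp only [pauliAt_eq_tensor, tensor_mul]
  have h : ∀ P Q : Pauli, (fun j =>
      Function.update (fun _ : Fin n => (1 : Matrix (Fin 2) (Fin 2) ℂ)) i P.mat j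
        * Function.update (fun _ : Fin n => (1 : Matrix (Fin 2) (Fin 2) ℂ)) i Q.mat j)
      = Function.update (fun _ => 1) i (P.mat * Q.mat) := fun P Q => by
    ext1 j
    by_cases hj : j = i
    · subst hj; simp
    · simp [hj]
  have hXZ : Pauli.X.mat * Pauli.Z.mat = -(Pauli.Z.mat * Pauli.X.mat) := by
    ext a b
    fin_cases a <;> fin_cases b <;> simp [Pauli.mat]
  rw [h, h, hXZ]
  ext a b
  simp only [tensor, Matrix.of_apply, Matrix.neg_apply]
  rw [← Finset.mul_prod_erase _ _ (Finset.mem_univ i),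
    ← Finset.mul_prod_erase _ _ (Finset.mem_univ i)]
  simp only [Function.update_self, Matrix.neg_apply, neg_mul]
  congr 2
  refine Finset.prod_congr rfl fun j hj => ?_
  simp [Finset.ne_of_mem_erase hj]

/-- The Bloch vector of a qubit has norm at most one: `X_i ψ` and `Z_i ψ` are unit vectors, and
they are orthogonal for the real inner product because `X_i` and `Z_i` anticommute. -/
theorem expval_X_sq_add_expval_Z_sq_le {n : ℕ} (i : Fin n) (ψ : PureState n) :
    expval (pauliAt Pauli.X i) ψ ^ 2 + expval (pauliAt Pauli.Z i) ψ ^ 2 ≤ 1 := by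
  set x := expval (pauliAt Pauli.X i) ψ with hx
  set z := expval (pauliAt Pauli.Z i) ψ with hz
  set e := Matrix.toEuclideanLin (pauliAt Pauli.X i) ψ.1 with he
  set f := Matrix.toEuclideanLin (pauliAt Pauli.Z i) ψ.1 with hf
  have he1 : ‖e‖ = 1 := (norm_unitary_apply (pauliString_mem_unitary _) ψ.1).trans ψ.2
  have hf1 : ‖f‖ = 1 := (norm_unitary_apply (pauliString_mem_unitary _) ψ.1).trans ψ.2
  have key : ∀ (P Q : Pauli), inner ℂ (Matrix.toEuclideanLin (pauliAt P i) ψ.1)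
      (Matrix.toEuclideanLin (pauliAt Q i) ψ.1)
      = inner ℂ ψ.1 (Matrix.toEuclideanLin (pauliAt P i * pauliAt Q i) ψ.1) := fun P Q => by
    rw [← LinearMap.adjoint_inner_right, ← Matrix.toEuclideanLin_conjTranspose_eq_adjoint]
    congr 1
    rw [pauliAt, pauliString_conjTranspose]
    simp only [Matrix.toLpLin_apply, Matrix.mulVec_mulVec]
  have hef : (inner ℂ e f : ℂ).re = 0 := by
    have h1 : (inner ℂ e f : ℂ) = -inner ℂ f e := by
      rw [he, hf, key, key, pauliAt_X_mul_Z, map_neg, LinearMap.neg_apply, inner_neg_right]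
    have h2 : (inner ℂ f e : ℂ).re = (inner ℂ e f : ℂ).re := by
      rw [← inner_conj_symm, Complex.conj_re]
    have h3 := congrArg Complex.re h1
    rw [Complex.neg_re, h2] at h3
    linarith
  have hn : ‖(x : ℂ) • e + (z : ℂ) • f‖ ^ 2 = x ^ 2 + z ^ 2 := by
    rw [@norm_add_sq ℂ, norm_smul, norm_smul, he1, hf1, inner_smul_left, inner_smul_right]
    simp [hef]
  have hc : (inner ℂ ψ.1 ((x : ℂ) • e + (z : ℂ) • f) : ℂ).re = x ^ 2 + z ^ 2 := by
    rw [inner_add_right, inner_smul_right, inner_smul_right, Complex.add_re, Complex.re_ofReal_mul,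
      Complex.re_ofReal_mul]
    rw [hx, hz, expval, expval]
    ring
  have hle : x ^ 2 + z ^ 2 ≤ ‖(x : ℂ) • e + (z : ℂ) • f‖ := by
    rw [← hc]
    refine (Complex.re_le_norm _).trans ((norm_inner_le_norm _ _).trans ?_)
    rw [ψ.2, one_mul]
  nlinarith [norm_nonneg ((x : ℂ) • e + (z : ℂ) • f), sq_nonneg (x ^ 2 + z ^ 2)]

/-! ### The answer of the oracle as a biased coin -/

/-- The oracle encoding `H` answers `E` with probability `p ψ` and `-E` otherwise, stated through
the expectations of functions of the answer. -/
def IsTwoPoint {n : ℕ} (H : Operator n) (E : ℝ) (p : PureState n → ℝ) : Prop :=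
  ∀ (ψ : PureState n) (F : ℝ → ℝ≥0∞), ∑' y, oracle H ψ y * F y
    = ENNReal.ofReal (p ψ) * F E + ENNReal.ofReal (1 - p ψ) * F (-E)

theorem tsum_bind_mul {α β : Type*} (P : PMF α) (f : α → PMF β) (F : β → ℝ≥0∞) :
    ∑' y, P.bind f y * F y = ∑' a, P a * ∑' y, f a y * F y := by
  simp only [PMF.bind_apply, ← ENNReal.tsum_mul_right, ← ENNReal.tsum_mul_left]
  rw [ENNReal.tsum_comm]
  simp only [mul_assoc]

theorem tsum_pure_mul {α : Type*} (a : α) (F : α → ℝ≥0∞) :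
    ∑' y, PMF.pure a y * F y = F a := by
  rw [tsum_eq_single a]
  · simp
  · intro y hy
    simp [PMF.pure_apply, hy]

theorem tsum_map_mul {α β : Type*} (P : PMF α) (f : α → β) (F : β → ℝ≥0∞) :
    ∑' y, P.map f y * F y = ∑' a, P a * F (f a) := by
  rw [← PMF.bind_pure_comp, tsum_bind_mul]
  simp only [Function.comp, tsum_pure_mul]

theorem tsum_measurePauli_mul {n : ℕ} (s : Fin n → Pauli) (ψ : PureState n) (F : ℤˣ → ℝ≥0∞) :
    ∑' m, measurePauli s ψ m * F m
      = ENNReal.ofReal ((1 + expval (pauliString s) ψ) / 2) * F 1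
        + ENNReal.ofReal ((1 - expval (pauliString s) ψ) / 2) * F (-1) := by
  rw [tsum_fintype, UnitsInt.univ, Finset.sum_pair (by decide)]
  simp [measurePauli, sub_eq_add_neg]

theorem oracle_isTwoPoint {n : ℕ} (d : (Fin n → Pauli) → ℝ) (hd : 0 < ∑ s, |d s|) :
    IsTwoPoint (∑ s, ((d s : ℝ) : ℂ) • pauliString s) (∑ s, |d s|)
      (fun ψ => (1 + expval (∑ s, ((d s : ℝ) : ℂ) • pauliString s) ψ / ∑ s, |d s|) / 2) := by
  intro ψ F
  dsimp only
  rw [expval_sum_smul]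
  set H := ∑ s, ((d s : ℝ) : ℂ) • pauliString s with hHdef
  set E := ∑ s, |d s| with hE
  have hc : ∀ s, pauliCoeff H s = d s := pauliCoeff_sum d
  have hH : ∃ s, pauliCoeff H s ≠ 0 := by
    by_contra! h
    have h0 : E = 0 := Finset.sum_eq_zero fun s _ => by rw [← hc, h, abs_zero]
    exact hd.ne' h0
  have hN : pauliNorm H = E := by simp only [pauliNorm, hc, hE]
  have hS : ∀ s, sampleTerm H hH s = ENNReal.ofReal (|d s| / E) := fun s => by
    simp only [sampleTerm, PMF.normalize_apply, hc]
    rw [tsum_fintype, ← ENNReal.ofReal_sum_of_nonneg (fun s _ => abs_nonneg (d s)), ← hE,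
      ← ENNReal.ofReal_inv_of_pos hd, ← ENNReal.ofReal_mul (abs_nonneg _), div_eq_mul_inv]
  have hx : ∀ s, |expval (pauliString s) ψ| ≤ 1 := fun s => abs_expval_pauliString_le s ψ
  have hdx : ∀ s, |d s * expval (pauliString s) ψ| ≤ |d s| := fun s => by
    rw [abs_mul]
    exact mul_le_of_le_one_right (abs_nonneg _) (hx s)
  have hterm : ∀ s, sampleTerm H hH s *
      ∑' y, (((measurePauli s ψ).map fun a : ℤˣ => (a : ℤ)).map fun m : ℤ =>
        pauliNorm H * (((SignType.sign (pauliCoeff H s) : SignType) : ℝ) * (m : ℝ))) y * F y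
      = ENNReal.ofReal ((|d s| + d s * expval (pauliString s) ψ) / (2 * E)) * F E
        + ENNReal.ofReal ((|d s| - d s * expval (pauliString s) ψ) / (2 * E)) * F (-E) := by
    intro s
    rw [tsum_map_mul, tsum_map_mul, tsum_measurePauli_mul, hS, hN, hc, mul_add,
      ← mul_assoc (ENNReal.ofReal _), ← mul_assoc (ENNReal.ofReal _),
      ← ENNReal.ofReal_mul (by positivity), ← ENNReal.ofReal_mul (by positivity)]
    rcases lt_trichotomy (d s) 0 with h | h | h
    · rw [add_comm]
      simp only [sign_neg h, abs_of_neg h, SignType.coe_neg_one,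
        Units.val_neg, Units.val_one, Int.cast_neg, Int.cast_one, mul_neg, mul_one, neg_neg]
      congr 3 <;> field_simp <;> ring
    · simp [h]
    · simp only [sign_pos h, abs_of_pos h, SignType.coe_one, Units.val_neg,
        Units.val_one, Int.cast_neg, Int.cast_one, mul_neg, mul_one]
      congr 3 <;> field_simp
  rw [oracle, dif_pos hH, tsum_bind_mul, tsum_fintype]
  refine (Finset.sum_congr rfl fun s _ => hterm s).trans ?_
  rw [Finset.sum_add_distrib, ← Finset.sum_mul, ← Finset.sum_mul,
    ← ENNReal.ofReal_sum_of_nonneg, ← ENNReal.ofReal_sum_of_nonneg, ← Finset.sum_div,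
    ← Finset.sum_div, Finset.sum_add_distrib, Finset.sum_sub_distrib, ← hE]
  · congr 3 <;> field_simp
    ring
  · intro s _
    have := abs_le.1 (hdx s)
    exact div_nonneg (by linarith) (by linarith)
  · intro s _
    have := abs_le.1 (hdx s)
    exact div_nonneg (by linarith) (by linarith)

/-! ### Strategies run against a biased coin -/

namespace Strategy

/-- The expectation of `g` at the output state when a query of `ψ` is answered by `E` with
probability `p ψ` and by `-E` with probability `1 - p ψ`. -/
def value {n : ℕ} (p : PureState n → ℝ) (E : ℝ) (g : PureState n → ℝ) : Strategy n → ℝ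
  | halt ψ => g ψ
  | query q next => p q.state * (next E).value p E g + (1 - p q.state) * (next (-E)).value p E g

/-- The expected total, over the queried states `ψ`, of `(p ψ - q ψ)² / (p ψ (1 - p ψ))` when the
answers follow `p`. This plays the role of the relative entropy between the laws of the transcript
for the answer probabilities `p` and `q`. -/
def info {n : ℕ} (p q : PureState n → ℝ) (E : ℝ) : Strategy n → ℝ
  | halt _ => 0
  | query a next => (p a.state - q a.state) ^ 2 / (p a.state * (1 - p a.state))
      + (p a.state * (next E).info p q E + (1 - p a.state) * (next (-E)).info p q E)

variable {n : ℕ} {H : Operator n} {E : ℝ} {p : PureState n → ℝ}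

theorem tsum_run_mul (hH : IsTwoPoint H E p) (hp : ∀ ψ, 0 ≤ p ψ ∧ p ψ ≤ 1)
    {g : PureState n → ℝ} (hg : ∀ ψ, 0 ≤ g ψ) (A : Strategy n) :
    0 ≤ A.value p E g ∧
      ∑' ψ, A.run H ψ * ENNReal.ofReal (g ψ) = ENNReal.ofReal (A.value p E g) := by
  induction A with
  | halt ψ => exact ⟨hg ψ, by rw [run, tsum_pure_mul, value]⟩
  | query q next ih =>
    have h := hp q.state
    have h1 : 0 ≤ 1 - p q.state := by linarith
    have h2 := mul_nonneg h.1 (ih E).1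
    have h3 := mul_nonneg h1 (ih (-E)).1
    refine ⟨add_nonneg h2 h3, ?_⟩
    rw [run, tsum_bind_mul]
    simp only [fun y => (ih y).2]
    rw [hH, value, ENNReal.ofReal_add h2 h3, ENNReal.ofReal_mul h.1, ENNReal.ofReal_mul h1]

theorem value_mono (hp : ∀ ψ, 0 ≤ p ψ ∧ p ψ ≤ 1) {f g : PureState n → ℝ} (hfg : ∀ ψ, f ψ ≤ g ψ)
    (A : Strategy n) : A.value p E f ≤ A.value p E g := by
  induction A with
  | halt ψ => exact hfg ψ
  | query q next ih =>
    have h := hp q.state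
    exact add_le_add (mul_le_mul_of_nonneg_left (ih E) h.1)
      (mul_le_mul_of_nonneg_left (ih (-E)) (by linarith))

theorem value_const (c : ℝ) (A : Strategy n) : A.value p E (fun _ => c) = c := by
  induction A with
  | halt ψ => rfl
  | query q next ih => rw [value, ih, ih]; ring

theorem value_sub (f g : PureState n → ℝ) (A : Strategy n) :
    A.value p E (fun ψ => f ψ - g ψ) = A.value p E f - A.value p E g := by
  induction A with
  | halt ψ => rfl
  | query q next ih => simp only [value, ih]; ring

theorem value_mul_sum {ι : Type*} (S : Finset ι) (c : ℝ) (f : ι → PureState n → ℝ)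
    (A : Strategy n) :
    A.value p E (fun ψ => c * ∑ i ∈ S, f i ψ) = c * ∑ i ∈ S, A.value p E (f i) := by
  induction A with
  | halt ψ => rfl
  | query q next ih =>
    simp only [value, ih, Finset.sum_add_distrib, ← Finset.mul_sum]
    ring

/-- The change of measure at a single query. The strictly concave function `x ↦ 1 - (1 - x) ^ 2`
loses `p (1 - p) (a - b) ^ 2` under averaging, which absorbs the first-order effect of replacing
`p` by `q` at the price of a term quadratic in `p - q`. -/
theorem one_sub_sq_average_le {p q a b : ℝ} (hp : 0 < p ∧ p < 1) (hq : 0 ≤ q ∧ q ≤ 1)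
    (ha : 0 ≤ a ∧ a ≤ 1) (hb : 0 ≤ b ∧ b ≤ 1) :
    p * (1 - (1 - a) ^ 2) + (1 - p) * (1 - (1 - b) ^ 2)
      ≤ (p - q) ^ 2 / (p * (1 - p)) + (1 - (1 - (q * a + (1 - q) * b)) ^ 2) := by
  have hr : 0 < p * (1 - p) := mul_pos hp.1 (by linarith [hp.2])
  set r := p * (1 - p) with hrdef
  have hmp : ∀ t : ℝ, 0 ≤ t ∧ t ≤ 1 → 0 ≤ t * a + (1 - t) * b ∧ t * a + (1 - t) * b ≤ 1 := by
    intro t ht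
    constructor
    · nlinarith [mul_nonneg ht.1 ha.1, mul_nonneg (sub_nonneg.2 ht.2) hb.1]
    · nlinarith [mul_nonneg ht.1 (sub_nonneg.2 ha.2),
        mul_nonneg (sub_nonneg.2 ht.2) (sub_nonneg.2 hb.2)]
  have h1 := hmp p ⟨hp.1.le, hp.2.le⟩
  have h2 := hmp q hq
  set k := 2 - (p * a + (1 - p) * b) - (q * a + (1 - q) * b) with hk
  have hk0 : 0 ≤ k := by linarith [h1.2, h2.2]
  have hk2 : k ≤ 2 := by linarith [h1.1, h2.1]
  set D := (p - q) ^ 2 / r with hD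
  have hDr : D * r = (p - q) ^ 2 := div_mul_cancel₀ _ hr.ne'
  have hid : p * (1 - (1 - a) ^ 2) + (1 - p) * (1 - (1 - b) ^ 2)
      - (1 - (1 - (q * a + (1 - q) * b)) ^ 2) = (p - q) * (a - b) * k - r * (a - b) ^ 2 := by
    rw [hk, hrdef]; ring
  have hmain : (p - q) * (a - b) * k ≤ D + r * (a - b) ^ 2 := by
    -- after multiplication by `r`, this is `x y k ≤ x ^ 2 + y ^ 2` for `0 ≤ k ≤ 2`
    refine le_of_mul_le_mul_right ?_ hr
    rw [add_mul, hDr]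
    set y := r * (a - b)
    have hy : (p - q) * y * k ≤ (p - q) ^ 2 + y ^ 2 := by
      have h4 : (p - q) * y * k ≤ |(p - q) * y| * 2 :=
        (mul_le_mul_of_nonneg_right (le_abs_self _) hk0).trans
          (mul_le_mul_of_nonneg_left hk2 (abs_nonneg _))
      rw [abs_mul] at h4
      nlinarith [sq_nonneg (|p - q| - |y|), sq_abs (p - q), sq_abs y]
    calc (p - q) * (a - b) * k * r = (p - q) * y * k := by ring
      _ ≤ (p - q) ^ 2 + y ^ 2 := hy
      _ = _ := by ring
  linarith

/-- The change of measure for adaptive strategies: a test that is unlikely to fire for the answer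
probabilities `q` is not certain to fire for `p`, unless the strategy collects much
information. -/
theorem value_le_info_add {q : PureState n → ℝ} (hp : ∀ ψ, 0 < p ψ ∧ p ψ < 1)
    (hq : ∀ ψ, 0 ≤ q ψ ∧ q ψ ≤ 1) {g : PureState n → ℝ} (hg : ∀ ψ, 0 ≤ g ψ ∧ g ψ ≤ 1)
    (A : Strategy n) :
    A.value p E g ≤ A.info p q E + (1 - (1 - A.value q E g) ^ 2) := by
  induction A with
  | halt ψ =>
    simp only [value, info]
    nlinarith [mul_nonneg (hg ψ).1 (sub_nonneg.2 (hg ψ).2)]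
  | query s next ih =>
    have hv : ∀ y, 0 ≤ (next y).value q E g ∧ (next y).value q E g ≤ 1 := fun y =>
      ⟨(value_const 0 _).symm.le.trans (value_mono hq (fun ψ => (hg ψ).1) _),
        (value_mono hq (fun ψ => (hg ψ).2) _).trans (value_const 1 _).le⟩
    have h := one_sub_sq_average_le (hp s.state) (hq s.state) (hv E) (hv (-E))
    have h1 := mul_le_mul_of_nonneg_left (ih E) (hp s.state).1.le
    have h2 := mul_le_mul_of_nonneg_left (ih (-E)) (sub_nonneg.2 (hp s.state).2.le)
    simp only [value, info]
    linarith

theorem mem_support_oracle (hH : IsTwoPoint H E p) (hp : ∀ ψ, 0 < p ψ ∧ p ψ < 1)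
    (ψ : PureState n) : E ∈ (oracle H ψ).support ∧ -E ∈ (oracle H ψ).support := by
  have h : ∀ e, ∑' y, oracle H ψ y * (if y = e then 1 else 0) = oracle H ψ e := fun e => by
    rw [tsum_eq_single e]
    · simp
    · intro y hy
      simp [hy]
  have h1 : ENNReal.ofReal (p ψ) ≠ 0 := by simpa using (hp ψ).1
  have h2 : ENNReal.ofReal (1 - p ψ) ≠ 0 := by simpa using (hp ψ).2
  constructor
  · rw [PMF.mem_support_iff, ← h, hH]
    simp [h1]
  · rw [PMF.mem_support_iff, ← h, hH]
    simp [h2]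

/-- If every admissible query has small total information about a family of alternatives, so has
the strategy, in proportion to the number of its queries. -/
theorem sum_info_le {ι : Type*} [Fintype ι] (hH : IsTwoPoint H E p)
    (hp : ∀ ψ, 0 < p ψ ∧ p ψ < 1) (q : ι → PureState n → ℝ) {D : Set (PureState n)} {K : ℝ}
    (hK : 0 ≤ K) (hD : ∀ ψ ∈ D, ∑ i, (p ψ - q i ψ) ^ 2 / (p ψ * (1 - p ψ)) ≤ K)
    (A : Strategy n) (T : ℕ) (hT : A.MakesAtMost H T) (hQ : A.QueriesOnlyIn H D) :
    ∑ i, A.info p (q i) E ≤ T * K := by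
  induction A generalizing T with
  | halt ψ =>
    simp only [info, Finset.sum_const_zero]
    positivity
  | query s next ih =>
    cases T with
    | zero => exact hT.elim
    | succ T =>
      obtain ⟨hs1, hs2⟩ := mem_support_oracle hH hp s.state
      have h1 := ih E T (hT _ hs1) (hQ.2 _ hs1)
      have h2 := ih (-E) T (hT _ hs2) (hQ.2 _ hs2)
      have h3 := hD _ hQ.1
      have h4 := mul_le_mul_of_nonneg_left h1 (hp s.state).1.le
      have h5 := mul_le_mul_of_nonneg_left h2 (sub_nonneg.2 (hp s.state).2.le)
      simp only [info, Finset.sum_add_distrib, ← Finset.mul_sum]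
      push_cast
      linarith

end Strategy

/-! ### The ground state energy of an observable of the family -/

theorem pauliAt_mulVec_prod {n : ℕ} (P : Pauli) (i : Fin n) (f : Fin n → Fin 2 → ℂ)
    (a : Basis n) : (pauliAt P i).mulVec (fun b => ∏ j, f j (b j)) a
      = P.mat.mulVec (f i) (a i) * ∏ j ∈ Finset.univ.erase i, f j (a j) := by
  rw [pauliAt_eq_tensor, tensor_mulVec]
  dsimp only
  rw [← Finset.mul_prod_erase _ _ (Finset.mem_univ i), Function.update_self]
  congr 1
  refine Finset.prod_congr rfl fun j hj => ?_
  simp [Finset.ne_of_mem_erase hj]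

theorem observable_isHermitian {n : ℕ} (δ : ℝ) (v : Fin n → ℤˣ) :
    (observable δ v).IsHermitian := by
  simp only [Matrix.IsHermitian, observable, Matrix.conjTranspose_neg, Matrix.conjTranspose_sum,
    Matrix.conjTranspose_add, Matrix.conjTranspose_smul, pauliAt, pauliString_conjTranspose,
    Complex.star_def, Complex.conj_ofReal]

/-- The product state of the qubit states `(cos (a / 2), sin (a / 2))`, which are fixed by
`sin a X + cos a Z`, is an eigenvector with eigenvalue `-n`. -/
theorem lambdaMin_observable_le {n : ℕ} (δ : ℝ) (v : Fin n → ℤˣ) :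
    lambdaMin (observable δ v) ≤ -n := by
  have hbdd : BddBelow (spectrum ℝ (observable δ v)) := by
    rw [(observable_isHermitian δ v).spectrum_real_eq_range_eigenvalues]
    exact (Set.finite_range _).bddBelow
  refine csInf_le hbdd ?_
  set a : Fin n → ℝ := fun i => Real.pi / 4 + ((v i : ℤ) : ℝ) * δ
  let f : Fin n → Fin 2 → ℂ := fun i =>
    ![((Real.cos (a i / 2) : ℝ) : ℂ), ((Real.sin (a i / 2) : ℝ) : ℂ)]
  let φ : Basis n → ℂ := fun b => ∏ j, f j (b j)
  have hf : ∀ i k, ((Real.sin (a i) : ℝ) : ℂ) * Pauli.X.mat.mulVec (f i) k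
      + ((Real.cos (a i) : ℝ) : ℂ) * Pauli.Z.mat.mulVec (f i) k = f i k := by
    intro i k
    have h1 : Real.cos (a i / 2) = Real.cos (a i) * Real.cos (a i / 2)
        + Real.sin (a i) * Real.sin (a i / 2) := by rw [← Real.cos_sub]; ring_nf
    have h2 : Real.sin (a i / 2) = Real.sin (a i) * Real.cos (a i / 2)
        - Real.cos (a i) * Real.sin (a i / 2) := by rw [← Real.sin_sub]; ring_nf
    fin_cases k
    · have h := congrArg (fun t : ℝ => (t : ℂ)) h1
      push_cast at h
      simp [f, Pauli.mat, Matrix.mulVec, dotProduct, Fin.sum_univ_two]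
      linear_combination -h
    · have h := congrArg (fun t : ℝ => (t : ℂ)) h2
      push_cast at h
      simp [f, Pauli.mat, Matrix.mulVec, dotProduct, Fin.sum_univ_two]
      linear_combination -h
  have heig : (observable δ v).mulVec φ = (-(n : ℂ)) • φ := by
    ext b
    have hi : ∀ i, ((Real.sin (a i) : ℝ) : ℂ) * (pauliAt Pauli.X i).mulVec φ b
        + ((Real.cos (a i) : ℝ) : ℂ) * (pauliAt Pauli.Z i).mulVec φ b = φ b := by
      intro i
      simp only [φ]
      rw [pauliAt_mulVec_prod, pauliAt_mulVec_prod, ← mul_assoc, ← mul_assoc, ← add_mul, hf,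
        Finset.mul_prod_erase Finset.univ (fun j => f j (b j)) (Finset.mem_univ i)]
    simp only [observable, Matrix.neg_mulVec, Matrix.sum_mulVec, Matrix.add_mulVec,
      Matrix.smul_mulVec, Pi.neg_apply, Finset.sum_apply, Pi.add_apply, Pi.smul_apply,
      smul_eq_mul]
    rw [Finset.sum_congr rfl fun i _ => hi i]
    simp
  have hφ : φ ≠ 0 := by
    have hk : ∀ i, ∃ k, f i k ≠ 0 := by
      intro i
      by_contra! h
      have h0 : Real.cos (a i / 2) = 0 := Complex.ofReal_eq_zero.1 (h 0)
      have h1 : Real.sin (a i / 2) = 0 := Complex.ofReal_eq_zero.1 (h 1)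
      have := Real.sin_sq_add_cos_sq (a i / 2)
      simp [h0, h1] at this
    choose b hb using hk
    intro h
    exact Finset.prod_ne_zero_iff.2 (fun i _ => hb i) (congrFun h b)
  rw [spectrum.mem_iff]
  rintro ⟨U, hU⟩
  apply hφ
  have h0 : (U : Operator n).mulVec φ = 0 := by
    rw [hU, Matrix.sub_mulVec, heig, Algebra.algebraMap_eq_smul_one, Matrix.smul_mulVec,
      Matrix.one_mulVec]
    ext b
    simp
  calc φ = ((↑U⁻¹ : Operator n) * (U : Operator n)).mulVec φ := by simp
    _ = 0 := by rw [← Matrix.mulVec_mulVec, h0, Matrix.mulVec_zero]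

/-! ### Coordinates adapted to the family -/

/-- The component of the Bloch vector of qubit `i` along the bisector of the `X` and `Z` axes, the
direction about which the ground states of the family are centered. -/
def along {n : ℕ} (i : Fin n) (ψ : PureState n) : ℝ :=
  (expval (pauliAt Pauli.X i) ψ + expval (pauliAt Pauli.Z i) ψ) / √2

/-- The component of the Bloch vector of qubit `i` orthogonal to the bisector of the `X` and `Z`
axes, whose sign estimates the hidden sign `v i`. -/
def skew {n : ℕ} (i : Fin n) (ψ : PureState n) : ℝ :=
  (expval (pauliAt Pauli.X i) ψ - expval (pauliAt Pauli.Z i) ψ) / √2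

theorem along_sq_add_skew_sq_le {n : ℕ} (i : Fin n) (ψ : PureState n) :
    along i ψ ^ 2 + skew i ψ ^ 2 ≤ 1 := by
  have h := expval_X_sq_add_expval_Z_sq_le i ψ
  rw [along, skew, div_pow, div_pow, Real.sq_sqrt (by norm_num)]
  linarith

theorem units_cast_sq (u : ℤˣ) : ((u : ℤ) : ℝ) ^ 2 = 1 := by
  rcases Int.units_eq_one_or u with h | h <;> simp [h]

theorem sin_pi_div_four_add (u : ℤˣ) (δ : ℝ) :
    Real.sin (Real.pi / 4 + ((u : ℤ) : ℝ) * δ)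
      = (Real.cos δ + ((u : ℤ) : ℝ) * Real.sin δ) / √2 := by
  rw [Real.sin_add, Real.sin_pi_div_four, Real.cos_pi_div_four,
    Real.sqrt_div_self']
  rcases Int.units_eq_one_or u with h | h <;> simp [h] <;> ring

theorem cos_pi_div_four_add (u : ℤˣ) (δ : ℝ) :
    Real.cos (Real.pi / 4 + ((u : ℤ) : ℝ) * δ)
      = (Real.cos δ - ((u : ℤ) : ℝ) * Real.sin δ) / √2 := by
  rw [Real.cos_add, Real.sin_pi_div_four, Real.cos_pi_div_four,
    Real.sqrt_div_self']
  rcases Int.units_eq_one_or u with h | h <;> simp [h] <;> ring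

/-- The contribution of qubit `i` to the energy of `-observable δ v`. -/
def gain {n : ℕ} (δ : ℝ) (v : Fin n → ℤˣ) (i : Fin n) (ψ : PureState n) : ℝ :=
  Real.cos δ * along i ψ + ((v i : ℤ) : ℝ) * Real.sin δ * skew i ψ

theorem expval_observable {n : ℕ} (δ : ℝ) (v : Fin n → ℤˣ) (ψ : PureState n) :
    expval (observable δ v) ψ = -∑ i, gain δ v i ψ := by
  rw [observable, expval_neg, Finset.sum_add_distrib, expval_add, expval_sum_smul,
    expval_sum_smul, ← Finset.sum_add_distrib]
  congr 1
  refine Finset.sum_congr rfl fun i _ => ?_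
  rw [sin_pi_div_four_add, cos_pi_div_four_add, gain, along, skew]
  ring

theorem abs_gain_le {n : ℕ} (δ : ℝ) (v : Fin n → ℤˣ) (i : Fin n) (ψ : PureState n) :
    |gain δ v i ψ| ≤ 1 := by
  have h1 := along_sq_add_skew_sq_le i ψ
  have h2 := Real.sin_sq_add_cos_sq δ
  have h3 := units_cast_sq (v i)
  rw [gain]
  set u := ((v i : ℤ) : ℝ)
  have h4 : (u * Real.sin δ) ^ 2 = Real.sin δ ^ 2 := by rw [mul_pow, h3, one_mul]
  rw [abs_le]
  constructor
  · nlinarith [sq_nonneg (along i ψ + Real.cos δ), sq_nonneg (skew i ψ + u * Real.sin δ)]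
  · nlinarith [sq_nonneg (along i ψ - Real.cos δ), sq_nonneg (skew i ψ - u * Real.sin δ)]

/-- A qubit close to its ground state for some member of the family has a small skew component. -/
theorem skew_sq_le {n : ℕ} (δ : ℝ) (v : Fin n → ℤˣ) (i : Fin n) (ψ : PureState n) :
    skew i ψ ^ 2 ≤ 4 * (1 - gain δ v i ψ) + 2 * Real.sin δ ^ 2 := by
  have h1 := along_sq_add_skew_sq_le i ψ
  have h2 := Real.sin_sq_add_cos_sq δ
  have h3 := units_cast_sq (v i)
  rw [gain]
  set u := ((v i : ℤ) : ℝ)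
  have h4 : (u * Real.sin δ) ^ 2 = Real.sin δ ^ 2 := by rw [mul_pow, h3, one_mul]
  nlinarith [sq_nonneg (along i ψ - Real.cos δ), sq_nonneg (skew i ψ - 2 * (u * Real.sin δ))]

/-! ### The oracle of an observable of the family -/

/-- The coefficient of the Pauli string `s` in `observable δ v`. -/
def weight {n : ℕ} (δ : ℝ) (v : Fin n → ℤˣ) (s : Fin n → Pauli) : ℝ :=
  -∑ i, (Real.sin (Real.pi / 4 + ((v i : ℤ) : ℝ) * δ)
      * (if s = Function.update (fun _ => Pauli.I) i Pauli.X then 1 else 0)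
    + Real.cos (Real.pi / 4 + ((v i : ℤ) : ℝ) * δ)
      * (if s = Function.update (fun _ => Pauli.I) i Pauli.Z then 1 else 0))

theorem observable_eq_sum_weight {n : ℕ} (δ : ℝ) (v : Fin n → ℤˣ) :
    observable δ v = ∑ s, ((weight δ v s : ℝ) : ℂ) • pauliString s := by
  simp only [weight, Complex.ofReal_neg, Complex.ofReal_sum, neg_smul, Finset.sum_neg_distrib,
    Finset.sum_smul, Complex.ofReal_add, Complex.ofReal_mul, add_smul]
  rw [observable, Finset.sum_comm]
  congr 1
  refine Finset.sum_congr rfl fun i _ => ?_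
  simp only [Finset.sum_add_distrib, pauliAt, apply_ite Complex.ofReal, Complex.ofReal_one,
    Complex.ofReal_zero, mul_ite, mul_one, mul_zero, ite_smul, zero_smul, Finset.sum_ite_eq',
    Finset.mem_univ, if_true]

/-- The normalization factor of the sampling oracle does not depend on the hidden signs. -/
theorem sum_abs_weight {n : ℕ} {δ : ℝ} (hδ : |Real.sin δ| ≤ Real.cos δ) (v : Fin n → ℤˣ) :
    ∑ s, |weight δ v s| = n * (√2 * Real.cos δ) := by
  have h := abs_le.1 hδ
  have hs : ∀ i, 0 ≤ Real.sin (Real.pi / 4 + ((v i : ℤ) : ℝ) * δ) := fun i => by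
    rw [sin_pi_div_four_add]
    refine div_nonneg ?_ (Real.sqrt_nonneg _)
    rcases Int.units_eq_one_or (v i) with hv | hv <;> simp [hv] <;> linarith
  have hc : ∀ i, 0 ≤ Real.cos (Real.pi / 4 + ((v i : ℤ) : ℝ) * δ) := fun i => by
    rw [cos_pi_div_four_add]
    refine div_nonneg ?_ (Real.sqrt_nonneg _)
    rcases Int.units_eq_one_or (v i) with hv | hv <;> simp [hv] <;> linarith
  have habs : ∀ s, |weight δ v s| = ∑ i, (Real.sin (Real.pi / 4 + ((v i : ℤ) : ℝ) * δ)
      * (if s = Function.update (fun _ => Pauli.I) i Pauli.X then 1 else 0)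
    + Real.cos (Real.pi / 4 + ((v i : ℤ) : ℝ) * δ)
      * (if s = Function.update (fun _ => Pauli.I) i Pauli.Z then 1 else 0)) := fun s => by
    rw [weight, abs_neg, abs_of_nonneg]
    refine Finset.sum_nonneg fun i _ => add_nonneg (mul_nonneg (hs i) ?_) (mul_nonneg (hc i) ?_)
    · split_ifs <;> norm_num
    · split_ifs <;> norm_num
  simp only [habs]
  rw [Finset.sum_comm]
  have hi : ∀ i : Fin n, ∑ s : Fin n → Pauli, (Real.sin (Real.pi / 4 + ((v i : ℤ) : ℝ) * δ)
      * (if s = Function.update (fun _ => Pauli.I) i Pauli.X then 1 else 0)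
    + Real.cos (Real.pi / 4 + ((v i : ℤ) : ℝ) * δ)
      * (if s = Function.update (fun _ => Pauli.I) i Pauli.Z then 1 else 0))
      = √2 * Real.cos δ := fun i => by
    rw [Finset.sum_add_distrib, ← Finset.mul_sum, ← Finset.mul_sum]
    simp only [Finset.sum_ite_eq', Finset.mem_univ, if_true, mul_one]
    rw [sin_pi_div_four_add, cos_pi_div_four_add]
    field_simp
    rw [Real.sq_sqrt (by norm_num)]
    ring
  rw [Finset.sum_congr rfl fun i _ => hi i]
  simp

/-- The probability of the answer `E` to a query of `ψ` when the oracle encodes `observable δ v`,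
where `E = n √2 cos δ`. -/
def coin {n : ℕ} (δ : ℝ) (v : Fin n → ℤˣ) (ψ : PureState n) : ℝ :=
  (1 + expval (observable δ v) ψ / (n * (√2 * Real.cos δ))) / 2

theorem observable_isTwoPoint {n : ℕ} (hn : 0 < n) {δ : ℝ} (hc : 0 < Real.cos δ)
    (hδ : |Real.sin δ| ≤ Real.cos δ) (v : Fin n → ℤˣ) :
    IsTwoPoint (observable δ v) (n * (√2 * Real.cos δ)) (coin δ v) := by
  have h := oracle_isTwoPoint (weight δ v) (by rw [sum_abs_weight hδ]; positivity)
  rw [← observable_eq_sum_weight, sum_abs_weight hδ] at h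
  exact h

/-- The answers of the oracle stay noisy even at the optimum: the variance of the coin is bounded
below. -/
theorem le_coin_mul_one_sub_coin {n : ℕ} (hn : 0 < n) {δ : ℝ} (hc : 0 < Real.cos δ)
    (hs : Real.sin δ ^ 2 ≤ 0.45) (v : Fin n → ℤˣ) (ψ : PureState n) :
    1 / 44 ≤ coin δ v ψ * (1 - coin δ v ψ) ∧ 0 < coin δ v ψ ∧ coin δ v ψ < 1 := by
  have hn' : (0 : ℝ) < n := by exact_mod_cast hn
  have hE : |expval (observable δ v) ψ| ≤ n := by
    rw [expval_observable, abs_neg]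
    refine (Finset.abs_sum_le_sum_abs _ _).trans
      ((Finset.sum_le_sum fun i _ => abs_gain_le δ v i ψ).trans ?_)
    simp
  have hsc := Real.sin_sq_add_cos_sq δ
  set m := expval (observable δ v) ψ / (n * (√2 * Real.cos δ)) with hm
  -- `m ^ 2 ≤ 1 / (2 cos² δ)` with `cos² δ ≥ 0.55`
  have hm2 : m ^ 2 ≤ 10 / 11 := by
    rw [hm, div_pow, div_le_iff₀ (by positivity), mul_pow, mul_pow, Real.sq_sqrt (by norm_num),
      ← sq_abs]
    have h1 : |expval (observable δ v) ψ| ^ 2 ≤ (n : ℝ) ^ 2 :=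
      pow_le_pow_left₀ (abs_nonneg _) hE 2
    nlinarith [sq_nonneg (n : ℝ)]
  have hcoin : coin δ v ψ = (1 + m) / 2 := rfl
  rw [hcoin]
  have hm1 : -1 < m ∧ m < 1 := abs_lt.1 ((sq_lt_one_iff_abs_lt_one m).1 (by linarith))
  refine ⟨by nlinarith, by linarith [hm1.1], by linarith [hm1.2]⟩

/-- The sign vector `v` with its `i`-th entry flipped. -/
def flipAt {n : ℕ} (v : Fin n → ℤˣ) (i : Fin n) : Fin n → ℤˣ := Function.update v i (-v i)

theorem flipAt_flipAt {n : ℕ} (v : Fin n → ℤˣ) (i : Fin n) : flipAt (flipAt v i) i = v := by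
  simp [flipAt]

theorem sum_flipAt {n : ℕ} (i : Fin n) (F : (Fin n → ℤˣ) → ℝ) :
    ∑ v, F (flipAt v i) = ∑ v, F v :=
  Equiv.sum_comp (Function.Involutive.toPerm (fun v => flipAt v i) fun v => flipAt_flipAt v i) F

theorem expval_observable_sub_flipAt {n : ℕ} (δ : ℝ) (v : Fin n → ℤˣ) (i : Fin n)
    (ψ : PureState n) : expval (observable δ v) ψ - expval (observable δ (flipAt v i)) ψ
      = -(2 * ((v i : ℤ) : ℝ) * Real.sin δ * skew i ψ) := by
  rw [expval_observable, expval_observable, neg_sub_neg, ← Finset.sum_sub_distrib,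
    Finset.sum_eq_single i]
  · simp [gain, flipAt]
    ring
  · intro j _ hj
    simp [gain, flipAt, hj]
  · simp

/-- A query of `ψ` carries little information about the sign `v i` when qubit `i` has a small skew
component. -/
theorem coin_divergence_le {n : ℕ} (hn : 0 < n) {δ : ℝ} (hc : 0 < Real.cos δ)
    (hs : Real.sin δ ^ 2 ≤ 0.45) (v : Fin n → ℤˣ) (i : Fin n) (ψ : PureState n) :
    (coin δ v ψ - coin δ (flipAt v i) ψ) ^ 2 / (coin δ v ψ * (1 - coin δ v ψ))
      ≤ 40 * Real.sin δ ^ 2 / n ^ 2 * skew i ψ ^ 2 := by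
  have hn' : (0 : ℝ) < n := by exact_mod_cast hn
  obtain ⟨h1, -, -⟩ := le_coin_mul_one_sub_coin hn hc hs v ψ
  have h2 : coin δ v ψ - coin δ (flipAt v i) ψ
      = -(((v i : ℤ) : ℝ) * Real.sin δ * skew i ψ) / (n * (√2 * Real.cos δ)) := by
    have h := expval_observable_sub_flipAt δ v i ψ
    calc coin δ v ψ - coin δ (flipAt v i) ψ
        = (expval (observable δ v) ψ - expval (observable δ (flipAt v i)) ψ) / 2
            / (n * (√2 * Real.cos δ)) := by rw [coin, coin]; ring
      _ = _ := by rw [h]; ring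
  have hsc := Real.sin_sq_add_cos_sq δ
  rw [div_le_iff₀ (by linarith), h2, div_pow, neg_sq, mul_pow, mul_pow, units_cast_sq, mul_pow,
    mul_pow, Real.sq_sqrt (by norm_num), one_mul, div_le_iff₀ (by positivity)]
  -- the product is at least `40 (1 / 44) (2 * 0.55) = 1`
  have h3 : (1 : ℝ) ≤ 40 * (coin δ v ψ * (1 - coin δ v ψ)) * (2 * Real.cos δ ^ 2) := by nlinarith
  calc Real.sin δ ^ 2 * skew i ψ ^ 2
      ≤ Real.sin δ ^ 2 * skew i ψ ^ 2
        * (40 * (coin δ v ψ * (1 - coin δ v ψ)) * (2 * Real.cos δ ^ 2)) :=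
        le_mul_of_one_le_right (by positivity) h3
    _ = _ := by field_simp

/-! ### Decoding the hidden signs from the output -/

open Classical in
/-- The indicator of the event that the sign of the skew component of qubit `i` fails to reveal
`v i`. -/
def wrong {n : ℕ} (v : Fin n → ℤˣ) (i : Fin n) (ψ : PureState n) : ℝ :=
  if 0 < ((v i : ℤ) : ℝ) * skew i ψ then 0 else 1

theorem wrong_nonneg {n : ℕ} (v : Fin n → ℤˣ) (i : Fin n) (ψ : PureState n) :
    0 ≤ wrong v i ψ := by
  rw [wrong]; split_ifs <;> norm_num

theorem wrong_le_one {n : ℕ} (v : Fin n → ℤˣ) (i : Fin n) (ψ : PureState n) :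
    wrong v i ψ ≤ 1 := by
  rw [wrong]; split_ifs <;> norm_num

theorem one_sub_wrong_le {n : ℕ} (v : Fin n → ℤˣ) (i : Fin n) (ψ : PureState n) :
    1 - wrong v i ψ ≤ wrong (flipAt v i) i ψ := by
  have h : (((flipAt v i i : ℤˣ) : ℤ) : ℝ) = -((v i : ℤ) : ℝ) := by simp [flipAt]
  rw [wrong, wrong, h]
  split_ifs <;> linarith

theorem mul_wrong_le {n : ℕ} {δ : ℝ} (hc : 0 ≤ Real.cos δ) (hs : 0 ≤ Real.sin δ)
    (v : Fin n → ℤˣ) (i : Fin n) (ψ : PureState n) :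
    (1 - Real.cos δ) * wrong v i ψ ≤ 1 - gain δ v i ψ := by
  rw [wrong]
  split_ifs with h
  · linarith [(abs_le.1 (abs_gain_le δ v i ψ)).2]
  · have h1 := along_sq_add_skew_sq_le i ψ
    have h2 : along i ψ ≤ 1 := by nlinarith [sq_nonneg (skew i ψ)]
    have h3 := mul_le_mul_of_nonneg_left h2 hc
    have h4 := mul_nonneg hs (sub_nonneg.2 (not_lt.1 h))
    rw [gain]
    linarith

/-- The output error dominates the number of wrongly decoded signs. -/
theorem mul_sum_wrong_le {n : ℕ} {δ : ℝ} (hc : 0 ≤ Real.cos δ) (hs : 0 ≤ Real.sin δ)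
    (v : Fin n → ℤˣ) (ψ : PureState n) :
    (1 - Real.cos δ) * ∑ i, wrong v i ψ
      ≤ expval (observable δ v) ψ - lambdaMin (observable δ v) := by
  have h1 := lambdaMin_observable_le δ v
  have h2 : ∑ i, (1 - gain δ v i ψ) = n - ∑ i, gain δ v i ψ := by
    rw [Finset.sum_sub_distrib]; simp
  have h3 := Finset.sum_le_sum fun i (_ : i ∈ Finset.univ) => mul_wrong_le hc hs v i ψ
  rw [← Finset.mul_sum, h2] at h3
  rw [expval_observable]
  linarith

/-! ### The lower bound -/

/-- Assouad's argument for a fixed seed. The signs `v` and `flipAt v i` are hard to tell apart, so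
on average over `v` and `i` a constant fraction of the signs is decoded wrongly, unless the total
information `T K` is of order `n`. The error bound, `(1 - cos δ) n η` on average over `v`, is
written so that `η` bounds the fraction of wrong signs; `K` bounds the information of one query. -/
theorem card_le_of_deterministic {n : ℕ} (hn : 0 < n) {δ : ℝ} (hc : 0 < Real.cos δ)
    (hs0 : 0 ≤ Real.sin δ) (hs : Real.sin δ ^ 2 ≤ 0.45) {η K : ℝ} (hK : 0 ≤ K) (hη : 0 ≤ η)
    {D : Set (PureState n)}
    (hD : ∀ ψ ∈ D, 40 * Real.sin δ ^ 2 / n ^ 2 * ∑ i, skew i ψ ^ 2 ≤ K)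
    (A : Strategy n) (T : ℕ) (hT : ∀ v, A.MakesAtMost (observable δ v) T)
    (hQ : ∀ v, A.QueriesOnlyIn (observable δ v) D)
    (herr : ∑ v : Fin n → ℤˣ, A.expectedError (observable δ v)
      ≤ ENNReal.ofReal (2 ^ n * ((1 - Real.cos δ) * (n * η)))) (hδ : Real.cos δ < 1) :
    (n : ℝ) * (1 - 3 * η) ≤ T * K := by
  have hsc := Real.sin_sq_add_cos_sq δ
  have hsc' : |Real.sin δ| ≤ Real.cos δ := by
    rw [abs_of_nonneg hs0]
    exact abs_le_of_sq_le_sq' (by linarith) hc.le |>.2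
  have hcoin := fun v ψ => (le_coin_mul_one_sub_coin hn hc hs v ψ).2
  have hcoin' : ∀ (v : Fin n → ℤˣ) ψ, 0 ≤ coin δ v ψ ∧ coin δ v ψ ≤ 1 := fun v ψ =>
    ⟨(hcoin v ψ).1.le, (hcoin v ψ).2.le⟩
  set E := (n : ℝ) * (√2 * Real.cos δ)
  have h2 : ∀ v : Fin n → ℤˣ, IsTwoPoint (observable δ v) E (coin δ v) :=
    observable_isTwoPoint hn hc hsc'
  set α : (Fin n → ℤˣ) → Fin n → ℝ := fun v i => A.value (coin δ v) E (wrong v i) with hα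
  have h1c : 0 < 1 - Real.cos δ := by linarith
  -- a small error allows few wrong signs
  have hfew : ∑ v, ∑ i, α v i ≤ 2 ^ n * (n * η) := by
    have hv : ∀ v, ENNReal.ofReal ((1 - Real.cos δ) * ∑ i, α v i)
        ≤ A.expectedError (observable δ v) := fun v => by
      have h0 : ∀ ψ, 0 ≤ (1 - Real.cos δ) * ∑ i, wrong v i ψ := fun ψ =>
        mul_nonneg h1c.le (Finset.sum_nonneg fun i _ => wrong_nonneg v i ψ)
      rw [hα, ← Strategy.value_mul_sum,
        ← (Strategy.tsum_run_mul (h2 v) (hcoin' v) h0 A).2]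
      exact ENNReal.tsum_le_tsum fun ψ => mul_le_mul_right
        (ENNReal.ofReal_le_ofReal (mul_sum_wrong_le hc.le hs0 v ψ)) _
    have hα0 : ∀ v i, 0 ≤ α v i := fun v i =>
      (Strategy.tsum_run_mul (h2 v) (hcoin' v) (wrong_nonneg v i) A).1
    have hsum := (Finset.sum_le_sum fun v (_ : v ∈ Finset.univ) => hv v).trans herr
    rw [← ENNReal.ofReal_sum_of_nonneg fun v _ =>
        mul_nonneg h1c.le (Finset.sum_nonneg fun i _ => hα0 v i),
      ENNReal.ofReal_le_ofReal_iff (by positivity), ← Finset.mul_sum] at hsum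
    refine le_of_mul_le_mul_left ?_ h1c
    linarith
  -- two sign vectors that differ in one entry cannot both be decoded well
  have htwo : ∀ v i, 1 ≤ A.info (coin δ v) (coin δ (flipAt v i)) E + α v i
      + 2 * α (flipAt v i) i := fun v i => by
    have h := Strategy.value_le_info_add (E := E) (hcoin v) (hcoin' (flipAt v i))
      (g := fun ψ => 1 - wrong v i ψ)
      (fun ψ => ⟨by linarith [wrong_le_one v i ψ], by linarith [wrong_nonneg v i ψ]⟩) A
    have h3 : A.value (coin δ (flipAt v i)) E (fun ψ => 1 - wrong v i ψ) ≤ α (flipAt v i) i :=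
      Strategy.value_mono (hcoin' _) (one_sub_wrong_le v i) A
    rw [Strategy.value_sub (fun _ => 1), Strategy.value_sub (fun _ => 1), Strategy.value_const,
      Strategy.value_const] at h
    rw [Strategy.value_sub (fun _ => 1), Strategy.value_const] at h3
    simp only [hα] at h3 ⊢
    nlinarith [sq_nonneg (1 - A.value (coin δ (flipAt v i)) E (wrong v i))]
  have hinfo : ∀ v, ∑ i, A.info (coin δ v) (coin δ (flipAt v i)) E ≤ T * K := fun v =>
    Strategy.sum_info_le (h2 v) (hcoin v) (fun i => coin δ (flipAt v i)) hK
      (fun ψ hψ => by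
        refine (Finset.sum_le_sum fun i _ => coin_divergence_le hn hc hs v i ψ).trans ?_
        rw [← Finset.mul_sum]
        exact hD ψ hψ) A T (hT v) (hQ v)
  have hcard : ((Fintype.card (Fin n → ℤˣ) : ℕ) : ℝ) = 2 ^ n := by simp
  have hall : (2 : ℝ) ^ n * n ≤ 2 ^ n * (T * K) + ∑ v, ∑ i, α v i + 2 * ∑ v, ∑ i, α v i := by
    have hflip : ∑ v, ∑ i, α (flipAt v i) i = ∑ v, ∑ i, α v i := by
      rw [Finset.sum_comm, Finset.sum_congr rfl fun i _ => sum_flipAt i fun v => α v i,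
        Finset.sum_comm]
    have h := Finset.sum_le_sum fun v (_ : v ∈ Finset.univ) =>
      Finset.sum_le_sum fun i (_ : i ∈ Finset.univ) => htwo v i
    have h' := Finset.sum_le_sum fun v (_ : v ∈ Finset.univ) => hinfo v
    simp only [Finset.sum_add_distrib, ← Finset.mul_sum, hflip, Finset.sum_const, Finset.card_univ,
      Fintype.card_fin, nsmul_eq_mul, mul_one, hcard] at h h'
    linarith
  have hpow : (0 : ℝ) < 2 ^ n := by positivity
  refine le_of_mul_le_mul_left ?_ hpow
  linarith

/-- For some seed, the expected errors sum up to no more than their worst-case bound allows, while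
all the conditions on the queries hold. -/
theorem exists_good_seed {n : ℕ} {Ω : Type*} [MeasurableSpace Ω] (A : ZerothOrderAlgorithm n Ω)
    {ε μ : ℝ} {T : ℕ} {η : ℝ≥0∞} (hm : A.IsMeasurable (family n ε))
    (hQ : A.IsVicinity (family n ε) μ) (hT : A.MakesAtMost (family n ε) T)
    (herr : A.err (family n ε) ≤ η) :
    ∃ ω, (∀ v, (A.strategy ω).MakesAtMost (observable (bias n ε) v) T) ∧
      (∀ v, (A.strategy ω).QueriesOnlyIn (observable (bias n ε) v)
        (optimumSet (family n ε) μ)) ∧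
      ∑ v : Fin n → ℤˣ, (A.strategy ω).expectedError (observable (bias n ε) v) ≤ 2 ^ n * η := by
  have := A.isProbabilityMeasure
  have hmem : ∀ v : Fin n → ℤˣ, observable (bias n ε) v ∈ family n ε := fun v => ⟨v, rfl⟩
  have hae : ∀ᵐ ω ∂A.seedLaw,
      (∀ v, (A.strategy ω).MakesAtMost (observable (bias n ε) v) T) ∧
      (∀ v, (A.strategy ω).QueriesOnlyIn (observable (bias n ε) v)
        (optimumSet (family n ε) μ)) :=
    (MeasureTheory.ae_all_iff.2 fun v => hT _ (hmem v)).and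
      (MeasureTheory.ae_all_iff.2 fun v => hQ _ (hmem v))
  have hint : ∫⁻ ω, ∑ v : Fin n → ℤˣ, (A.strategy ω).expectedError (observable (bias n ε) v)
      ∂A.seedLaw ≤ 2 ^ n * η := by
    rw [MeasureTheory.lintegral_finsetSum' _ fun v _ => hm _ (hmem v)]
    refine (Finset.sum_le_sum fun v _ =>
      (le_iSup₂_of_le (f := fun H (_ : H ∈ family n ε) =>
        ∫⁻ ω, (A.strategy ω).expectedError H ∂A.seedLaw) _ (hmem v) le_rfl).trans herr).trans ?_
    simp
  obtain ⟨ω, hω, hle⟩ := MeasureTheory.exists_notMem_null_le_lintegral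
    (Finset.aemeasurable_fun_sum _ fun v _ => hm _ (hmem v)) (MeasureTheory.ae_iff.1 hae)
  obtain ⟨h1, h2⟩ := not_not.1 hω
  exact ⟨ω, h1, h2, hle.trans hint⟩

/-- A state of the vicinity has small total skewness. -/
theorem sum_skew_sq_le {n : ℕ} {ε μ : ℝ} {ψ : PureState n}
    (hψ : ψ ∈ optimumSet (family n ε) μ) :
    ∑ i, skew i ψ ^ 2 ≤ 4 * μ + 2 * (n * Real.sin (bias n ε) ^ 2) := by
  obtain ⟨_, ⟨v, rfl⟩, h⟩ := hψ
  have h1 := lambdaMin_observable_le (bias n ε) v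
  have h2 := Finset.sum_le_sum fun i (_ : i ∈ Finset.univ) => skew_sq_le (bias n ε) v i ψ
  simp only [expval_observable] at h
  rw [Finset.sum_add_distrib, ← Finset.mul_sum, Finset.sum_sub_distrib] at h2
  simp only [Finset.sum_const, Finset.card_univ, Fintype.card_fin, nsmul_eq_mul, mul_one] at h2
  linarith

end VarOpt

end

theorem mainTheorem1 :
    ∃ c : ℝ, 0 < c ∧
      ∀ (n : ℕ) (ε : ℝ), 15 ≤ n → 0 < ε → ε ≤ 0.01 * n →
        ∀ (Ω : Type*) [MeasurableSpace Ω] (A : ZerothOrderAlgorithm n Ω) (T : ℕ),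
          A.IsMeasurable (family n ε) →
          A.IsVicinity (family n ε) (100 * ε) →
          A.MakesAtMost (family n ε) T →
          A.err (family n ε) ≤ ENNReal.ofReal ε →
          c * ((n : ℝ) ^ 3 / ε ^ 2) ≤ (T : ℝ) := by
  refine ⟨1 / 2000000, by norm_num, fun n ε hn hε hεn Ω _ A T hm hQ hT herr => ?_⟩
  have hn0 : 0 < n := by omega
  have hn1 : (1 : ℝ) ≤ n := by exact_mod_cast hn0
  have hn' : (0 : ℝ) < n := by linarith
  set δ := bias n ε with hδ
  have hδ2 : δ ^ 2 = 45 * ε / n := Real.sq_sqrt (by positivity)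
  have hδ2' : δ ^ 2 ≤ 0.45 := by
    rw [hδ2, div_le_iff₀ hn']
    linarith
  have hδ0 : 0 < δ := Real.sqrt_pos.2 (by positivity)
  have hδ1 : δ ≤ 1 := by nlinarith
  have hsin : Real.sin δ ^ 2 ≤ δ ^ 2 := by
    rw [sq_le_sq, abs_of_pos hδ0]
    exact (Real.abs_sin_le_abs (x := δ)).trans_eq (abs_of_pos hδ0)
  have hs0 : 0 ≤ Real.sin δ :=
    Real.sin_nonneg_of_nonneg_of_le_pi hδ0.le (hδ1.trans (by linarith [Real.pi_gt_three]))
  have hcos : 0 < Real.cos δ := Real.cos_pos_of_le_one (by rwa [abs_of_pos hδ0])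
  -- `1 - cos δ` is close to `δ ^ 2 / 2`, so a wrong sign costs at least `0.4 δ ^ 2 = 18 ε / n`
  have hcos1 : 0.4 * δ ^ 2 ≤ 1 - Real.cos δ := by
    have h := (abs_le.1 (Real.cos_bound (x := δ) (by rwa [abs_of_pos hδ0]))).2
    rw [abs_of_pos hδ0] at h
    nlinarith [sq_nonneg δ]
  have hcostε : ε ≤ (1 - Real.cos δ) * (n * (1 / 18)) := by
    have h : ε = 0.4 * δ ^ 2 * (n * (1 / 18)) := by
      rw [hδ2]; field_simp; norm_num
    calc ε = 0.4 * δ ^ 2 * (n * (1 / 18)) := h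
      _ ≤ _ := mul_le_mul_of_nonneg_right hcos1 (by positivity)
  obtain ⟨ω, hT', hQ', herr'⟩ := exists_good_seed A hm hQ hT herr
  -- the vicinity condition bounds the information of one query by `(1800 ε / n ^ 3) (490 ε)`, while
  -- an error of at most `ε` allows on average at most `n / 18` wrong signs
  have hmain := card_le_of_deterministic hn0 hcos hs0 (hsin.trans hδ2')
    (η := 1 / 18) (K := 882000 * ε ^ 2 / n ^ 3) (by positivity) (by norm_num)
    (fun ψ hψ => ?_) (A.strategy ω) T hT' hQ' (herr'.trans ?_) (by nlinarith [sq_pos_of_pos hδ0])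
  · rw [← mul_div_assoc, ← mul_div_assoc, le_div_iff₀ (by positivity)] at hmain
    rw [div_mul_div_comm, div_le_iff₀ (by positivity)]
    -- here `(15 / 18) n ^ 4 ≤ 882000 T ε ^ 2`, and one factor `n` is discarded
    have hpow : (n : ℝ) ^ 3 ≤ n * n ^ 3 := le_mul_of_one_le_left (by positivity) hn1
    have hTε : 0 ≤ (T : ℝ) * ε ^ 2 := by positivity
    nlinarith
  · have h1 := sum_skew_sq_le hψ
    have hns : (n : ℝ) * Real.sin δ ^ 2 ≤ 45 * ε := by
      calc (n : ℝ) * Real.sin δ ^ 2 ≤ n * δ ^ 2 := mul_le_mul_of_nonneg_left hsin hn'.le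
        _ = 45 * ε := by rw [hδ2]; field_simp
    have h2 : ∑ i, skew i ψ ^ 2 ≤ 490 * ε := by
      rw [← hδ] at h1
      linarith
    have h3 : 40 * Real.sin δ ^ 2 / (n : ℝ) ^ 2 ≤ 1800 * ε / n ^ 3 := by
      rw [div_le_div_iff₀ (by positivity) (by positivity)]
      have := mul_le_mul_of_nonneg_left hns (by positivity : 0 ≤ 40 * (n : ℝ) ^ 2)
      linarith
    calc 40 * Real.sin δ ^ 2 / (n : ℝ) ^ 2 * ∑ i, skew i ψ ^ 2
        ≤ 1800 * ε / n ^ 3 * (490 * ε) :=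
          mul_le_mul h3 h2 (Finset.sum_nonneg fun i _ => sq_nonneg _) (by positivity)
      _ = _ := by ring
  · rw [ENNReal.ofReal_mul (by positivity), ENNReal.ofReal_pow (by norm_num), ENNReal.ofReal_ofNat]
    exact mul_le_mul_right (ENNReal.ofReal_le_ofReal hcostε) _
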